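/- Let $\alpha,\mu,N$ be positive integers and $a_s,\rho,\Omega_s>0$. Let $g_s$ be the channel gain of the strong user over $\alpha$-$\mu$ fading, i.e. a random variable with density $$f_{g_s}(x)=\frac{\alpha\mu^{\mu}x^{\alpha\mu/2-1}}{2\,\Omega_s^{\alpha\mu}\,\Gamma(\mu)}\exp\Bigl(-\frac{\mu x^{\alpha/2}}{\Omega_s^{\alpha}}\Bigr),\qquad x>0 ,$$ and let $\varphi_s=(1+a_s\rho g_s)^{N/\ln 2}$. Write $\mathcal M_X(r)=\mathbb E[X^{r-1}]$ for the Mellin transform of a random variable $X$, $\varpi=N\mathscr S/\ln 2$, and $\Delta(x,y)$ for the list $\tfrac yx,\tfrac{y+1}x,\dots,\tfrac{y+x-1}x$. (i) For every $\mathscr S>0$, $\mathcal M_{\varphi_s}(1-\mathscr S)=\mathbb E[(1+a_s\rho g_s)^{-\varpi}]$ is finite and $$\mathcal M_{\varphi_s}(1-\mathscr S)=\frac{\alpha^{\varpi}\mu^{\mu}}{\sqrt2\,(2\pi)^{\alpha-1/2}\,\Omega_s^{\alpha\mu}\,\Gamma(\mu)\,\Gamma(\varpi)\,(a_s\rho)^{\alpha\mu/2}}\;G^{2+\alpha,\alpha}_{\alpha,2+\alpha}\!\left[\frac{\mu^2}{4(a_s\rho)^{\alpha}\Omega_s^{2\alpha}}\,\middle|\,\begin{matrix}\Delta(\alpha,1-\tfrac{\alpha\mu}2)\\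 \Delta(2,0),\ \Delta(\alpha,\varpi-\tfrac{\alpha\mu}2)\end{matrix}\right].$$ Here $G$ is Meijer's $G$-function, $G^{m,n}_{p,q}[z\,|\,a;b]=\frac1{2\pi i}\int_{c-i\infty}^{c+i\infty}\frac{\prod_{j\le m}\Gamma(b_j-s)\prod_{j\le n}\Gamma(1-a_j+s)}{\prod_{j>m}\Gamma(1-b_j+s)\prod_{j>n}\Gamma(a_j-s)}z^s\,ds$, where the line $\operatorname{Re}s=c$ separates the poles of the $\Gamma(b_j-s)$, $j\le m$, from those of the $\Gamma(1-a_j+s)$, $j\le n$; for the parameters above such a line exists, the integral converges absolutely on each such line, and its value does not depend on the line. (ii) Let the gains $g_s(0),g_s(1),\dots$ in successive time slots be independent with density $f_{g_s}$. Consider an initially empty, lossless, work-conserving queue with a constant arrival of $\lambda\ge0$ bits per slot, which in slot $k$ can serve up to $N\log_2(1+a_s\rho g_s(k))$ bits (arrivals of slot $k$ included). Let $A(0,t)$ and $D(0,t)$ be its cumulative arrivals and departures in slots $0,\dots,t-1$, and let $\vartheta_s(t)=\inf\{u\in\mathbb Z_{\ge0}:A(0,t)\le D(0,t+u)\}$ be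 the delay. Then, for all integers $t,\vartheta\ge0$, $$\Pr(\vartheta_s(t)>\vartheta)\le\inf_{\mathscr S}\frac{[\mathcal M_{\varphi_s}(1-\mathscr S)]^{\vartheta}}{1-e^{\lambda\mathscr S}\,\mathcal M_{\varphi_s}(1-\mathscr S)},$$ with $\mathcal M_{\varphi_s}(1-\mathscr S)$ replaced by the closed form of (i), where the infimum is over all $\mathscr S>0$ such that $e^{\lambda\mathscr S}\mathcal M_{\varphi_s}(1-\mathscr S)<1$ (and is $+\infty$ if there is no such $\mathscr S$). -/

import Mathlib

open MeasureTheory ProbabilityTheory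

/-! ### Meijer's G-function -/

/-- The Mellin-Barnes integrand of `G^{m,n}_{p,q}[z | a; b]`:
`∏_{j ≤ m} Γ(b_j - s) ∏_{j ≤ n} Γ(1 - a_j + s)
  / (∏_{j > m} Γ(1 - b_j + s) ∏_{j > n} Γ(a_j - s)) * z ^ s`. -/
noncomputable def meijerGIntegrand (m n : ℕ) {p q : ℕ} (a : Fin p → ℂ) (b : Fin q → ℂ)
    (z s : ℂ) : ℂ :=
  (∏ j : Fin q, if (j : ℕ) < m then Complex.Gamma (b j - s)
    else (Complex.Gamma (1 - b j + s))⁻¹) *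
  (∏ j : Fin p, if (j : ℕ) < n then Complex.Gamma (1 - a j + s)
    else (Complex.Gamma (a j - s))⁻¹) *
  z ^ s

/-- The vertical line `Re s = c` separates the poles of `Γ(b_j - s)`, `j ≤ m` (on its right),
from the poles of `Γ(1 - a_j + s)`, `j ≤ n` (on its left). -/
def MeijerGSeparates (m n : ℕ) {p q : ℕ} (a : Fin p → ℂ) (b : Fin q → ℂ) (c : ℝ) : Prop :=
  (∀ j : Fin q, (j : ℕ) < m → c < (b j).re) ∧ (∀ j : Fin p, (j : ℕ) < n → (a j).re - 1 < c)

/-- The Mellin-Barnes integral `(1 / 2πi) ∫ … ds` along the line `s = c + i y`, `y ∈ ℝ`. -/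
noncomputable def meijerGLine (m n : ℕ) {p q : ℕ} (a : Fin p → ℂ) (b : Fin q → ℂ) (z : ℂ)
    (c : ℝ) : ℂ :=
  (1 / (2 * Real.pi) : ℂ) * ∫ y : ℝ, meijerGIntegrand m n a b z (c + y * Complex.I)

open Classical in
/-- Meijer's G-function `G^{m,n}_{p,q}[z | a; b]`, through the Mellin-Barnes integral along a
vertical line separating the two families of poles (defined whenever there is such a line). -/
noncomputable def meijerG (m n : ℕ) {p q : ℕ} (a : Fin p → ℂ) (b : Fin q → ℂ) (z : ℂ) : ℂ :=
  if h : ∃ c : ℝ, MeijerGSeparates m n a b c then meijerGLine m n a b z h.choose else 0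

/-- The list `Δ(x, y) = y/x, (y+1)/x, …, (y+x-1)/x`. -/
noncomputable def paramDelta (x : ℕ) (y : ℝ) : Fin x → ℂ :=
  fun k => (((y + (k : ℕ)) / x : ℝ) : ℂ)

/-! ### The channel of the strong user -/

/-- The density of the channel gain `g = |h|²` of an `α`-`μ` fading link with `α`-root-mean
value `Ωs`. -/
noncomputable def alphaMuGainPDF (α μ : ℕ) (Ωs x : ℝ) : ℝ :=
  if 0 < x then
    (α * (μ : ℝ) ^ μ * x ^ ((α * μ : ℝ) / 2 - 1)) / (2 * Ωs ^ (α * μ) * Real.Gamma μ) *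
      Real.exp (-(μ * x ^ ((α : ℝ) / 2) / Ωs ^ α))
  else 0

/-- The law of the channel gain of an `α`-`μ` fading link. -/
noncomputable def alphaMuGainLaw (α μ : ℕ) (Ωs : ℝ) : Measure ℝ :=
  volume.withDensity fun x => ENNReal.ofReal (alphaMuGainPDF α μ Ωs x)

/-- The Mellin transform `E[X ^ (s - 1)]` of a random variable `X`. -/
noncomputable def mellinRV {W : Type*} [MeasurableSpace W] (P : Measure W) (X : W → ℝ)
    (s : ℝ) : ℝ :=
  ∫ ω, X ω ^ (s - 1) ∂P

/-- `φ_s = (1 + a_s ρ x) ^ (N / ln 2)` at the channel gain `x`. -/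
noncomputable def phiStrong (N : ℕ) (as ρ x : ℝ) : ℝ :=
  (1 + as * ρ * x) ^ ((N : ℝ) / Real.log 2)

/-- `ϖ = N S / ln 2`. -/
noncomputable def varpi (N : ℕ) (S : ℝ) : ℝ := N * S / Real.log 2

/-- The upper parameters `Δ(α, 1 - αμ/2)`. -/
noncomputable def upperParams (α μ : ℕ) : Fin α → ℂ :=
  paramDelta α (1 - (α * μ : ℝ) / 2)

/-- The lower parameters `Δ(2, 0), Δ(α, w - αμ/2)`. -/
noncomputable def lowerParams (α μ : ℕ) (w : ℝ) : Fin (2 + α) → ℂ :=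
  Fin.append (paramDelta 2 0) (paramDelta α (w - (α * μ : ℝ) / 2))

/-- The argument `μ² / (4 (a_s ρ)^α Ω_s^{2α})`. -/
noncomputable def meijerArg (α μ : ℕ) (as ρ Ωs : ℝ) : ℝ :=
  (μ : ℝ) ^ 2 / (4 * (as * ρ) ^ α * Ωs ^ (2 * α))

/-- The closed form of the Mellin transform of `φ_s`, as a function of `w = ϖ`. -/
noncomputable def mellinClosedForm (α μ : ℕ) (as ρ Ωs w : ℝ) : ℂ :=
  (((α : ℝ) ^ w * (μ : ℝ) ^ μ : ℝ) : ℂ) *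
      meijerG (2 + α) α (upperParams α μ) (lowerParams α μ w) (meijerArg α μ as ρ Ωs : ℂ) /
    ((√2 * (2 * Real.pi) ^ ((α : ℝ) - 1 / 2) * Ωs ^ (α * μ) * Real.Gamma μ * Real.Gamma w *
      (as * ρ) ^ ((α * μ : ℝ) / 2) : ℝ) : ℂ)

/-! ### The queue and its delay -/

/-- The number of bits that the strong user's link can carry in a slot of `N` symbols with
channel gain `x`; it is `ln φ_s`. -/
noncomputable def serviceStrong (N : ℕ) (as ρ x : ℝ) : ℝ :=
  N * Real.logb 2 (1 + as * ρ * x)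

/-- The cumulative process `X(τ, t) = ∑_{k = τ}^{t - 1} x(k)`. -/
def cumulative (x : ℕ → ℝ) (τ t : ℕ) : ℝ := ∑ k ∈ Finset.Ico τ t, x k

/-- The backlog at the beginning of each slot of an initially empty, lossless, work-conserving
queue with arrivals `arr k` and service `srv k` in slot `k`. -/
noncomputable def backlog (arr srv : ℕ → ℝ) : ℕ → ℝ
  | 0 => 0
  | k + 1 => max (backlog arr srv k + arr k - srv k) 0

/-- The traffic departing in slot `k`. -/
noncomputable def departure (arr srv : ℕ → ℝ) (k : ℕ) : ℝ :=
  min (backlog arr srv k + arr k) (srv k)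

/-- The delay `inf {u ≥ 0 : A(0, t) ≤ D(0, t + u)}` in slots (`⊤` if there is no such `u`). -/
noncomputable def queueDelay (arr srv : ℕ → ℝ) (t : ℕ) : ℕ∞ :=
  ⨅ (u : ℕ) (_ : cumulative arr 0 t ≤ cumulative (departure arr srv) 0 (t + u)), (u : ℕ∞)

/-! For (i), the function `(1 + x) ^ (-w)` has Mellin transform `Γ(s) Γ(w - s) / Γ(w)` (a Beta
integral), so Mellin inversion writes it as an integral over a line `0 < Re s < w`. Inserting this
in the expectation and exchanging the integrals leaves, in the gain variable, the Mellin transform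
of `exp (-β x ^ (α/2))`, which is again a Gamma value. With `s = αμ/2 + αt` the result is one line
integral of `Γ(s) Γ(w - s) Γ(-2t)` times powers. The Gauss multiplication formula (proved here from
Euler's limit and Stirling) splits the first two factors into the two lists of length `α`, and the
duplication formula splits `Γ(-2t)` into the list `Δ(2, 0)`; this is the integrand of `G` up to a
constant (`meijerGIntegrand_alphaMu`). Every separating line is treated in the same way and gives
the same expectation, so independence of the line needs no contour shift.

For (ii), `exp (-S · service) = φ_s ^ (-S)`, so the Mellin transform is the moment generating
function of the service at `-S`. The backlog is the net input since the queue last emptied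
(`exists_backlog_eq`); hence a delay above `θ` at `t` forces, for some `τ < t`, the service in `[τ,
t + θ)` below the arrivals in `[τ, t)`. Independence and Chernoff bound each such event, and the
union bound over `τ` is a geometric sum. -/

/-! ### The Gauss multiplication formula. -/

open Filter Topology in
theorem tendsto_factorial_mul_pow_div_factorial_add (p : ℕ) :
    Tendsto (fun n : ℕ => (n.factorial : ℝ) * (n : ℝ) ^ p / ((n + p).factorial : ℝ))
      atTop (𝓝 1) := by
  induction p with
  | zero =>
    refine tendsto_const_nhds.congr fun n => ?_
    have : (n.factorial : ℝ) ≠ 0 := by positivity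
    simp [this]
  | succ p ih =>
    have h : Tendsto (fun n : ℕ => (n : ℝ) / (n + ((p : ℝ) + 1))) atTop (𝓝 1) := by
      simpa using tendsto_natCast_div_add_atTop ((p : ℝ) + 1)
    have := ih.mul h
    rw [one_mul] at this
    refine this.congr fun n => ?_
    rw [← add_assoc n p 1, Nat.factorial_succ, pow_succ]
    have h1 : ((n + p).factorial : ℝ) ≠ 0 := by positivity
    have h2 : (n : ℝ) + (p + 1) ≠ 0 := by positivity
    have h3 : (n : ℝ) + p + 1 = n + (p + 1) := add_assoc _ _ _
    push_cast
    rw [h3]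
    field_simp

/-- The constant in the Gauss multiplication formula, as a limit. -/
theorem tendsto_gaussMultiplication_const (p : ℕ) :
    Filter.Tendsto (fun n : ℕ => √(n : ℝ) ^ p * (n.factorial : ℝ) ^ (p + 1) *
        ((p + 1 : ℕ) : ℝ) ^ ((p + 1) * (n + 1)) / (((p + 1) * n + p).factorial : ℝ))
      Filter.atTop (nhds (√(2 * Real.pi) ^ p * √((p + 1 : ℕ) : ℝ))) := by
  have hm : Filter.Tendsto (fun n : ℕ => (p + 1) * n) Filter.atTop Filter.atTop :=
    Filter.tendsto_id.const_mul_atTop' (Nat.succ_pos p)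
  have hs := Stirling.tendsto_stirlingSeq_sqrt_pi
  have hpi : √Real.pi ≠ 0 := by positivity
  -- The quotient of Stirling sequences at `n` and `(p+1) n` tends to `√π ^ p`; the second factor
  -- trades `((p+1) n)!` for `((p+1) n + p)!`.
  have h := (((hs.pow (p + 1)).div (hs.comp hm) hpi).mul
    ((tendsto_factorial_mul_pow_div_factorial_add p).comp hm)).const_mul
      (√2 ^ p * √((p + 1 : ℕ) : ℝ))
  have e : √2 ^ p * √((p + 1 : ℕ) : ℝ) * (√Real.pi ^ (p + 1) / √Real.pi * 1) =
      √(2 * Real.pi) ^ p * √((p + 1 : ℕ) : ℝ) := by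
    rw [Real.sqrt_mul (by norm_num), mul_pow, pow_succ √Real.pi]
    field_simp
  rw [e] at h
  refine h.congr' ?_
  filter_upwards [Filter.eventually_gt_atTop 0] with n hn
  simp only [Pi.div_apply, Function.comp_apply, Stirling.stirlingSeq]
  have hn' : (0 : ℝ) < n := by exact_mod_cast hn
  have hq : (0 : ℝ) < ((p + 1 : ℕ) : ℝ) := by positivity
  push_cast [Nat.cast_mul] at hq ⊢
  set q : ℝ := (p : ℝ) + 1 with hqdef
  have f1 : (n.factorial : ℝ) ≠ 0 := by positivity
  have f2 : (((p + 1) * n).factorial : ℝ) ≠ 0 := by positivity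
  have f3 : (((p + 1) * n + p).factorial : ℝ) ≠ 0 := by positivity
  have s1 : √(2 * (n : ℝ)) = √2 * √n := Real.sqrt_mul (by norm_num) _
  have s2 : √(2 * (q * n)) = √2 * (√q * √n) := by
    rw [Real.sqrt_mul (by norm_num), Real.sqrt_mul hq.le]
  have g2 : √(2 : ℝ) ≠ 0 := by positivity
  have gn : √(n : ℝ) ≠ 0 := by positivity
  have gq : √q ≠ 0 := by positivity
  have q2 : q = √q * √q := (Real.mul_self_sqrt hq.le).symm
  have n2 : (n : ℝ) = √n * √n := (Real.mul_self_sqrt hn'.le).symm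
  have e1 : (q * n / Real.exp 1) ^ ((p + 1) * n) =
      q ^ ((p + 1) * n) * ((n / Real.exp 1) ^ n) ^ (p + 1) := by
    rw [mul_div_assoc, mul_pow, ← pow_mul, mul_comm n]
  have e2 : q ^ ((p + 1) * (n + 1)) = q ^ ((p + 1) * n) * (q ^ p * (√q * √q)) := by
    rw [← q2, ← pow_succ, ← pow_add]; ring
  have e3 : (q * n) ^ p = q ^ p * (√n ^ p * √n ^ p) := by
    rw [mul_pow, ← mul_pow √(n : ℝ), ← n2]
  rw [s1, s2, e1, e2, e3]
  have x0 : (n / Real.exp 1 : ℝ) ^ n ≠ 0 := by positivity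
  generalize ((n / Real.exp 1 : ℝ) ^ n) = X at *
  have qa : q ^ ((p + 1) * n) ≠ 0 := by positivity
  generalize (q ^ ((p + 1) * n)) = Y at *
  rw [div_pow _ _ (p + 1), mul_pow _ _ (p + 1), mul_pow _ _ (p + 1)]
  field_simp
  ring

namespace Complex

theorem prod_cpow_eq_cpow_sum {ι : Type*} (t : Finset ι) (f : ι → ℂ) {x : ℂ} (hx : x ≠ 0) :
    ∏ i ∈ t, x ^ f i = x ^ ∑ i ∈ t, f i := by
  simp only [cpow_def_of_ne_zero hx, ← exp_sum, Finset.mul_sum]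

/-- With `q = p + 1`, each factor is `(q s + (k + q j)) / q`, and `k + q j` runs once through `0, …,
q n - 1`. -/
theorem prod_prod_add_div_add (p : ℕ) (s : ℂ) (n : ℕ) :
    ∏ k ∈ Finset.range (p + 1), ∏ j ∈ Finset.range n, (s + (k : ℂ) / ((p + 1 : ℕ) : ℂ) + j) =
      (∏ i ∈ Finset.range ((p + 1) * n), (((p + 1 : ℕ) : ℂ) * s + i)) /
        ((p + 1 : ℕ) : ℂ) ^ ((p + 1) * n) := by
  rw [Finset.prod_comm]
  have hq : ((p + 1 : ℕ) : ℂ) ≠ 0 := Nat.cast_ne_zero.mpr (Nat.succ_ne_zero p)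
  induction n with
  | zero => simp
  | succ n ih =>
    rw [Finset.prod_range_succ, ih, Nat.mul_succ, Finset.prod_range_add _ _ (p + 1),
      pow_add (((p + 1 : ℕ) : ℂ)) _ (p + 1),
      mul_div_mul_comm]
    congr 1
    rw [eq_div_iff (pow_ne_zero _ hq)]
    conv_lhs => rw [← Finset.card_range (p + 1)]
    rw [← Finset.prod_const, Finset.card_range, ← Finset.prod_mul_distrib]
    refine Finset.prod_congr rfl fun k _ => ?_
    rw [Nat.cast_add ((p + 1) * n), Nat.cast_mul]
    field_simp
    ring

/-- The `p + 1` Euler products with `n + 1` factors each merge into one with `(p+1)(n+1)` factors,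
which is the Euler product of index `(p+1) n + p`. -/
theorem prod_GammaSeq_add_div (p : ℕ) (s : ℂ) {n : ℕ} (hn : n ≠ 0) :
    ∏ k ∈ Finset.range (p + 1), GammaSeq (s + (k : ℂ) / ((p + 1 : ℕ) : ℂ)) n =
      ((√(n : ℝ) ^ p * (n.factorial : ℝ) ^ (p + 1) *
        ((p + 1 : ℕ) : ℝ) ^ ((p + 1) * (n + 1)) / (((p + 1) * n + p).factorial : ℝ) : ℝ) : ℂ) *
      (((n / ((p + 1) * n + p : ℕ) : ℝ) : ℂ) ^ (((p + 1 : ℕ) : ℂ) * s) *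
        GammaSeq (((p + 1 : ℕ) : ℂ) * s) ((p + 1) * n + p)) := by
  have hn0 : (n : ℂ) ≠ 0 := Nat.cast_ne_zero.mpr hn
  have hnr : (0 : ℝ) < n := by positivity
  have hq : ((p + 1 : ℕ) : ℂ) ≠ 0 := Nat.cast_ne_zero.mpr (Nat.succ_ne_zero p)
  have hM : ((p + 1) * n + p : ℕ) ≠ 0 := by positivity
  have hM0 : (((p + 1) * n + p : ℕ) : ℂ) ≠ 0 := Nat.cast_ne_zero.mpr hM
  have hf : ((((p + 1) * n + p).factorial : ℕ) : ℂ) ≠ 0 :=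
    Nat.cast_ne_zero.mpr (Nat.factorial_ne_zero _)
  have hpow : ∏ k ∈ Finset.range (p + 1), (n : ℂ) ^ (s + (k : ℂ) / ((p + 1 : ℕ) : ℂ)) =
      (n : ℂ) ^ (((p + 1 : ℕ) : ℂ) * s) * ((√(n : ℝ) : ℝ) : ℂ) ^ p := by
    rw [prod_cpow_eq_cpow_sum _ _ hn0]
    -- The shifts `k / (p+1)` add up to `p / 2`, the source of `√n ^ p`.
    have hsum : ∑ k ∈ Finset.range (p + 1), (s + (k : ℂ) / ((p + 1 : ℕ) : ℂ)) =
        ((p + 1 : ℕ) : ℂ) * s + (p : ℂ) * (1 / 2 : ℂ) := by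
      rw [Finset.sum_add_distrib, ← Finset.sum_div, Finset.sum_const, Finset.card_range,
        nsmul_eq_mul]
      have h2 : (∑ k ∈ Finset.range (p + 1), (k : ℂ)) * 2 = ((p + 1 : ℕ) : ℂ) * p := by
        have := Finset.sum_range_id_mul_two (p + 1)
        rw [Nat.add_sub_cancel] at this
        have := congrArg (Nat.cast : ℕ → ℂ) this
        push_cast at this ⊢
        exact this
      congr 1
      rw [div_eq_iff hq]
      linear_combination h2 / 2
    rw [hsum, cpow_add _ _ hn0]
    congr 1
    rw [mul_comm, ← ofReal_natCast n, cpow_mul_nat, Real.sqrt_eq_rpow, ofReal_cpow hnr.le]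
    norm_num
  have hdiv : ((n / ((p + 1) * n + p : ℕ) : ℝ) : ℂ) ^ (((p + 1 : ℕ) : ℂ) * s) =
      (n : ℂ) ^ (((p + 1 : ℕ) : ℂ) * s) /
        (((p + 1) * n + p : ℕ) : ℂ) ^ (((p + 1 : ℕ) : ℂ) * s) := by
    rw [← ofReal_natCast n, ← ofReal_natCast ((p + 1) * n + p), ofReal_div,
      div_cpow_ofReal_nonneg (Nat.cast_nonneg _) (Nat.cast_nonneg _)]
  simp only [GammaSeq, Finset.prod_div_distrib, Finset.prod_mul_distrib, Finset.prod_const,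
    Finset.card_range]
  rw [hpow, prod_prod_add_div_add, hdiv]
  have hM1 : (((p + 1) * n + p : ℕ) : ℂ) ^ (((p + 1 : ℕ) : ℂ) * s) ≠ 0 := by
    exact fun h => hM0 ((cpow_eq_zero_iff _ _).mp h).1
  have e : (p + 1) * n + p + 1 = (p + 1) * (n + 1) := by ring
  rw [e]
  simp only [ofReal_div, ofReal_mul, ofReal_pow, ofReal_natCast]
  generalize (∏ i ∈ Finset.range ((p + 1) * (n + 1)), (((p + 1 : ℕ) : ℂ) * s + i)) = Q
  generalize (((p + 1) * n + p : ℕ) : ℂ) ^ (((p + 1 : ℕ) : ℂ) * s) = R at *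
  have hqq : ((p + 1 : ℕ) : ℂ) ^ ((p + 1) * (n + 1)) ≠ 0 := pow_ne_zero _ hq
  generalize ((p + 1 : ℕ) : ℂ) ^ ((p + 1) * (n + 1)) = T at *
  -- If a linear factor vanishes, both sides are `0` by the convention `x / 0 = 0`.
  by_cases hQ : Q = 0
  · simp [hQ]
  field_simp

/-- **Gauss multiplication formula** for the Gamma function. -/
theorem prod_Gamma_add_div (p : ℕ) (s : ℂ) :
    ∏ k ∈ Finset.range (p + 1), Gamma (s + (k : ℂ) / ((p + 1 : ℕ) : ℂ)) =
      ((√(2 * Real.pi) ^ p * √((p + 1 : ℕ) : ℝ) : ℝ) : ℂ) *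
        (((1 / (p + 1 : ℕ) : ℝ) : ℂ) ^ (((p + 1 : ℕ) : ℂ) * s) *
          Gamma (((p + 1 : ℕ) : ℂ) * s)) := by
  have hl : Filter.Tendsto
      (fun n => ∏ k ∈ Finset.range (p + 1), GammaSeq (s + (k : ℂ) / ((p + 1 : ℕ) : ℂ)) n)
      Filter.atTop (nhds (∏ k ∈ Finset.range (p + 1), Gamma (s + (k : ℂ) / ((p + 1 : ℕ) : ℂ)))) :=
    tendsto_finsetProd _ fun k _ => GammaSeq_tendsto_Gamma _
  have hM : Filter.Tendsto (fun n : ℕ => (p + 1) * n + p) Filter.atTop Filter.atTop :=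
    Filter.tendsto_atTop_mono (fun n => Nat.le_add_right _ p)
      (Filter.Tendsto.const_mul_atTop' (Nat.succ_pos p) Filter.tendsto_id)
  have hG := (GammaSeq_tendsto_Gamma (((p + 1 : ℕ) : ℂ) * s)).comp hM
  have hq : (0 : ℝ) < ((p + 1 : ℕ) : ℝ) := by positivity
  have hratio : Filter.Tendsto (fun n : ℕ => ((n / ((p + 1) * n + p : ℕ) : ℝ)))
      Filter.atTop (nhds (1 / (p + 1 : ℕ) : ℝ)) := by
    have h := (tendsto_natCast_div_add_atTop ((p : ℝ) / ((p + 1 : ℕ) : ℝ))).mul_const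
      (1 / (p + 1 : ℕ) : ℝ)
    rw [one_mul] at h
    refine h.congr fun n => ?_
    rw [div_mul_div_comm, mul_one]
    congr 1
    rw [Nat.cast_add _ p, Nat.cast_mul]
    field_simp
  have hc : Filter.Tendsto
      (fun n : ℕ => ((n / ((p + 1) * n + p : ℕ) : ℝ) : ℂ) ^ (((p + 1 : ℕ) : ℂ) * s))
      Filter.atTop (nhds (((1 / (p + 1 : ℕ) : ℝ) : ℂ) ^ (((p + 1 : ℕ) : ℂ) * s))) := by
    refine ((continuousAt_ofReal_cpow_const _ _ (Or.inr ?_)).tendsto).comp hratio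
    positivity
  have hr := ((continuous_ofReal.tendsto _).comp (tendsto_gaussMultiplication_const p)).mul
    (hc.mul hG)
  refine tendsto_nhds_unique hl (hr.congr' ?_)
  filter_upwards [Filter.eventually_ne_atTop 0] with n hn
  exact (prod_GammaSeq_add_div p s hn).symm

end Complex

/-! ### Gamma on vertical lines. -/

namespace Complex

theorem norm_Gamma_le_of_re_pos {s : ℂ} (hs : 0 < s.re) : ‖Gamma s‖ ≤ Real.Gamma s.re := by
  rw [Gamma_eq_integral hs, GammaIntegral, Real.Gamma_eq_integral hs]
  refine (norm_integral_le_integral_norm _).trans_eq ?_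
  refine setIntegral_congr_fun measurableSet_Ioi fun x hx => ?_
  have hx' : 0 < x := hx
  rw [norm_mul, norm_cpow_eq_rpow_re_of_pos hx', norm_real, Real.norm_of_nonneg (Real.exp_pos _).le]
  simp

/-- The functional equation gains one power of decay; two such factors already give the integrable
majorant `1 / (1 + y²)`. -/
theorem norm_Gamma_le_div {s : ℂ} (hs : 0 < s.re) :
    ‖Gamma s‖ ≤ Real.Gamma (s.re + 1) / ‖s‖ := by
  have h0 : s ≠ 0 := fun h => by simp [h] at hs
  rw [le_div_iff₀ (norm_pos_iff.mpr h0), mul_comm, ← norm_mul, ← Gamma_add_one s h0]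
  refine (norm_Gamma_le_of_re_pos (s := s + 1) (by simp; linarith)).trans_eq (by simp)

theorem continuous_Gamma_vertical {σ : ℝ} (hσ : 0 < σ) (a : ℝ) :
    Continuous fun y : ℝ => Gamma (σ + (a * y : ℝ) * I) := by
  refine continuous_iff_continuousAt.mpr fun y => ?_
  refine ContinuousAt.comp (g := Gamma) (f := fun y : ℝ => (σ + (a * y : ℝ) * I : ℂ)) ?_
    (by fun_prop)
  refine (differentiableAt_Gamma _ fun m h => ?_).continuousAt
  have := congrArg re h
  simp at this
  have hm : (0 : ℝ) ≤ m := Nat.cast_nonneg m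
  linarith

/-- `Γ(s) Γ(w - s)` is absolutely integrable along vertical lines `0 < Re s < w`. -/
theorem integrable_Gamma_mul_Gamma_sub {σ w : ℝ} (hσ : 0 < σ) (hw : σ < w) :
    Integrable fun y : ℝ => Gamma (σ + y * I) * Gamma (w - (σ + y * I)) := by
  have hd : 0 < w - σ := sub_pos.mpr hw
  -- This `m` makes `m² (1 + z²) ≤ |τ + i z|²` for both `τ = σ` and `τ = w - σ`.
  set m := min 1 (min σ (w - σ)) with hm
  have hm0 : 0 < m := by positivity
  have e : ∀ y : ℝ, (w : ℂ) - (σ + y * I) = ((w - σ : ℝ) : ℂ) + ((-1 * y : ℝ) : ℂ) * I := by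
    intro y; push_cast; ring
  have hcont : Continuous fun y : ℝ => Gamma (σ + y * I) * Gamma (w - (σ + y * I)) := by
    simp only [e]
    refine Continuous.mul ?_ (continuous_Gamma_vertical hd (-1))
    simpa using continuous_Gamma_vertical hσ 1
  refine Integrable.mono' (g := fun y : ℝ => (Real.Gamma (σ + 1) * Real.Gamma (w - σ + 1) / m ^ 2) *
    (1 + y ^ 2)⁻¹) (integrable_inv_one_add_sq.const_mul _) hcont.aestronglyMeasurable
    (Filter.Eventually.of_forall fun y => ?_)
  have key : ∀ τ z : ℝ, m ≤ τ → m ^ 2 * (1 + z ^ 2) ≤ ‖(τ + z * I : ℂ)‖ ^ 2 := by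
    intro τ z hτ
    rw [← normSq_eq_norm_sq, normSq_add_mul_I]
    have h1 : m ^ 2 ≤ τ ^ 2 := pow_le_pow_left₀ hm0.le hτ 2
    have h2 : m ^ 2 ≤ 1 := pow_le_one₀ hm0.le (min_le_left _ _)
    nlinarith [sq_nonneg z]
  have k1 := key σ y ((min_le_right _ _).trans (min_le_left _ _))
  have k2 := key (w - σ) (-1 * y) ((min_le_right _ _).trans (min_le_right _ _))
  have g1 := norm_Gamma_le_div (s := σ + y * I) (by simpa using hσ)
  have g2 := norm_Gamma_le_div (s := w - (σ + y * I)) (by simpa using hw)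
  have r1 : (σ + y * I : ℂ).re = σ := by simp
  have r2 : ((w : ℂ) - (σ + y * I)).re = w - σ := by simp
  rw [r1] at g1
  rw [r2] at g2
  rw [← e] at k2
  have n1 : 0 < ‖(σ + y * I : ℂ)‖ := by
    rw [norm_pos_iff]; intro h; rw [h] at r1; simp at r1; linarith
  have n2 : 0 < ‖(w : ℂ) - (σ + y * I)‖ := by
    rw [norm_pos_iff]; intro h; rw [h] at r2; simp at r2; linarith
  rw [norm_mul]
  have G1 := Real.Gamma_pos_of_pos (show 0 < σ + 1 by linarith)
  have G2 := Real.Gamma_pos_of_pos (show 0 < w - σ + 1 by linarith)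
  refine (mul_le_mul g1 g2 (norm_nonneg _) (by positivity)).trans ?_
  have e0 : Real.Gamma (σ + 1) * Real.Gamma (w - σ + 1) / m ^ 2 * (1 + y ^ 2)⁻¹ =
      Real.Gamma (σ + 1) * Real.Gamma (w - σ + 1) / (m ^ 2 * (1 + y ^ 2)) := by
    rw [div_mul_eq_div_div, div_eq_mul_inv _ (1 + y ^ 2)]
  rw [div_mul_div_comm, e0]
  have : m ^ 2 * (1 + y ^ 2) ≤ ‖(σ + y * I : ℂ)‖ * ‖(w : ℂ) - (σ + y * I)‖ := by
    refine le_of_sq_le_sq ?_ (by positivity)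
    rw [mul_pow ‖(σ + y * I : ℂ)‖, sq (m ^ 2 * (1 + y ^ 2))]
    refine mul_le_mul k1 ?_ (by positivity) (by positivity)
    simpa using k2
  gcongr

end Complex

/-! ### Mellin-Barnes integrals for `(1 + x) ^ (-w)`. -/

theorem mellinConvergent_one_add_rpow_neg {σ w : ℝ} (hσ : 0 < σ) (hw : σ < w) :
    MellinConvergent (fun x : ℝ => (((1 + x) ^ (-w) : ℝ) : ℂ)) σ := by
  have hcont : ContinuousOn (fun x : ℝ => (1 + x) ^ (-w)) (Set.Ici 0) := by
    refine ContinuousOn.rpow_const (by fun_prop) fun x hx => Or.inl ?_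
    have : (0 : ℝ) ≤ x := hx
    positivity
  refine mellinConvergent_of_isBigO_rpow (a := w) (b := 0) ?_ ?_ (by simpa) ?_ (by simpa)
  · refine ContinuousOn.locallyIntegrableOn ?_ measurableSet_Ioi
    exact Complex.continuous_ofReal.comp_continuousOn (hcont.mono Set.Ioi_subset_Ici_self)
  · refine Asymptotics.IsBigO.of_bound 1 ?_
    filter_upwards [Filter.eventually_gt_atTop 0] with x hx
    rw [Complex.norm_real, one_mul, Real.norm_of_nonneg (by positivity),
      Real.norm_of_nonneg (by positivity)]
    exact Real.rpow_le_rpow_of_nonpos hx (by linarith) (by linarith)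
  · refine Asymptotics.IsBigO.of_bound 1 ?_
    filter_upwards [self_mem_nhdsWithin] with x hx
    have hx : 0 < x := hx
    rw [Complex.norm_real, one_mul, Real.norm_of_nonneg (by positivity)]
    simp only [neg_zero, Real.rpow_zero, norm_one]
    exact Real.rpow_le_one_of_one_le_of_nonpos (by linarith) (by linarith)

/-- The Mellin transform of `(1 + x) ^ (-w)`. -/
theorem mellin_one_add_rpow_neg {w : ℝ} {s : ℂ} (hs : 0 < s.re) (hsw : s.re < w) :
    mellin (fun x : ℝ => (((1 + x) ^ (-w) : ℝ) : ℂ)) s =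
      Complex.Gamma s * Complex.Gamma (w - s) / Complex.Gamma w := by
  have hd : 0 < (w - s : ℂ).re := by simpa using hsw
  have hB := Complex.Gamma_mul_Gamma_eq_betaIntegral hs hd
  rw [add_sub_cancel] at hB
  have hG : Complex.Gamma w ≠ 0 := Complex.Gamma_ne_zero_of_re_pos (by simp; linarith)
  rw [hB, mul_div_cancel_left₀ _ hG, Complex.betaIntegral, mellin,
    intervalIntegral.integral_of_le zero_le_one, integral_Ioc_eq_integral_Ioo]
  -- The substitution `x = u / (1 - u)` carries the Beta integral on `(0, 1)` to the half-line.
  have himg : (fun u : ℝ => u / (1 - u)) '' Set.Ioo 0 1 = Set.Ioi 0 := by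
    ext x
    constructor
    · rintro ⟨u, ⟨hu0, hu1⟩, rfl⟩
      exact div_pos hu0 (by linarith)
    · intro hx
      have hx : 0 < x := hx
      refine ⟨x / (1 + x), ⟨by positivity, (div_lt_one (by positivity)).mpr (by linarith)⟩, ?_⟩
      have : 1 + x ≠ 0 := by positivity
      field_simp
      ring_nf
  have hder : ∀ u ∈ Set.Ioo (0 : ℝ) 1,
      HasDerivWithinAt (fun u : ℝ => u / (1 - u)) (1 / (1 - u) ^ 2) (Set.Ioo 0 1) u := by
    intro u hu
    have h1 : 1 - u ≠ 0 := by linarith [hu.2]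
    have := ((hasDerivAt_id u).div ((hasDerivAt_id u).const_sub 1) h1).hasDerivWithinAt
      (s := Set.Ioo 0 1)
    refine this.congr_deriv ?_
    simp
  have hinj : Set.InjOn (fun u : ℝ => u / (1 - u)) (Set.Ioo 0 1) := by
    intro u hu v hv h
    have h1 : 1 - u ≠ 0 := by linarith [hu.2]
    have h2 : 1 - v ≠ 0 := by linarith [hv.2]
    have h : u / (1 - u) = v / (1 - v) := h
    rw [div_eq_div_iff h1 h2] at h
    linarith
  rw [← himg, integral_image_eq_integral_abs_deriv_smul measurableSet_Ioo hder hinj]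
  refine setIntegral_congr_fun measurableSet_Ioo fun u hu => ?_
  have h1 : 0 < 1 - u := by linarith [hu.2]
  have h1c : ((1 - u : ℝ) : ℂ) ≠ 0 := Complex.ofReal_ne_zero.mpr h1.ne'
  have e1 : 1 + u / (1 - u) = (1 - u)⁻¹ := by field_simp; ring
  simp only [e1]
  rw [Real.inv_rpow h1.le, Real.rpow_neg h1.le, inv_inv, abs_of_pos (by positivity),
    Complex.ofReal_div, Complex.div_cpow_ofReal_nonneg hu.1.le h1.le, Complex.ofReal_cpow h1.le,
    Complex.real_smul, smul_eq_mul]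
  have e2 : (1 - (u : ℂ)) = ((1 - u : ℝ) : ℂ) := by push_cast; ring
  rw [e2]
  have e3 : ((1 - u : ℝ) : ℂ) ^ (w : ℂ) =
      ((1 - u : ℝ) : ℂ) ^ ((w : ℂ) - s - 1) * ((1 - u : ℝ) : ℂ) ^ (s - 1) *
        ((1 - u : ℝ) : ℂ) ^ (2 : ℕ) := by
    rw [← Complex.cpow_natCast, ← Complex.cpow_add _ _ h1c, ← Complex.cpow_add _ _ h1c]
    congr 1
    push_cast
    ring
  rw [e3]
  have h3 : ((1 - u : ℝ) : ℂ) ^ (s - 1) ≠ 0 := by simp [Complex.cpow_eq_zero_iff, h1.ne', -Complex.ofReal_sub]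
  rw [Complex.ofReal_div, Complex.ofReal_pow, Complex.ofReal_one]
  field_simp

/-- Mellin-Barnes representation of `(1 + x) ^ (-w)`. -/
theorem one_add_rpow_neg_eq_mellinBarnes {σ w x : ℝ} (hσ : 0 < σ) (hw : σ < w) (hx : 0 < x) :
    (((1 + x) ^ (-w) : ℝ) : ℂ) = (1 / (2 * Real.pi) : ℂ) / Complex.Gamma w *
      ∫ y : ℝ, (x : ℂ) ^ (-(σ + y * Complex.I)) *
        (Complex.Gamma (σ + y * Complex.I) * Complex.Gamma (w - (σ + y * Complex.I))) := by
  have hm : ∀ y : ℝ, mellin (fun x : ℝ => (((1 + x) ^ (-w) : ℝ) : ℂ)) (σ + y * Complex.I) =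
      Complex.Gamma (σ + y * Complex.I) * Complex.Gamma (w - (σ + y * Complex.I)) /
        Complex.Gamma w := fun y =>
    mellin_one_add_rpow_neg (by simpa using hσ) (by simpa using hw)
  have h := mellinInv_mellin_eq σ (fun x : ℝ => (((1 + x) ^ (-w) : ℝ) : ℂ)) hx
    (mellinConvergent_one_add_rpow_neg hσ hw)
    (by
      unfold Complex.VerticalIntegrable
      simp only [hm]
      exact (Complex.integrable_Gamma_mul_Gamma_sub hσ hw).div_const _)
    (by
      refine Complex.continuous_ofReal.continuousAt.comp ?_
      exact ContinuousAt.rpow_const (by fun_prop) (Or.inl (by positivity)))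
  rw [← h, mellinInv]
  simp only [hm, smul_eq_mul, ← mul_div_assoc]
  rw [integral_div, Complex.real_smul]
  push_cast
  ring

theorem Complex.ofReal_cpow_eq_exp {x : ℝ} (hx : 0 < x) (s : ℂ) :
    (x : ℂ) ^ s = Complex.exp ((Real.log x : ℝ) * s) := by
  rw [Complex.cpow_def_of_ne_zero (Complex.ofReal_ne_zero.mpr hx.ne'), Complex.ofReal_log hx.le]

theorem mellin_exp_neg_mul_rpow {a β : ℝ} (ha : 0 < a) (hβ : 0 < β) {s : ℂ} (hs : 0 < s.re) :
    mellin (fun x : ℝ => ((Real.exp (-(β * x ^ a)) : ℝ) : ℂ)) s =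
      (1 / a : ℝ) * ((β : ℂ) ^ (-(s / a)) * Complex.Gamma (s / a)) := by
  have h1 := mellin_comp_rpow (fun x : ℝ => ((Real.exp (-(β * x)) : ℝ) : ℂ)) s a
  have h2 := mellin_comp_mul_left (fun x : ℝ => ((Real.exp (-x) : ℝ) : ℂ)) (s / a) hβ
  rw [h1, h2, ← Complex.GammaIntegral_eq_mellin, ← Complex.Gamma_eq_integral, abs_of_pos ha,
    Complex.real_smul, smul_eq_mul, one_div]
  rw [Complex.div_ofReal_re]
  positivity

theorem integrableOn_rpow_mul_exp_neg_mul_rpow_mul_rpow {p a β κ σ : ℝ} (ha : 0 < a)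
    (hβ : 0 < β) (hκ : 0 < κ) (hσp : σ < p) :
    IntegrableOn (fun x : ℝ => x ^ (p - 1) * Real.exp (-(β * x ^ a)) * (κ * x) ^ (-σ))
      (Set.Ioi 0) := by
  have h := (integrableOn_rpow_mul_exp_neg_mul_rpow (p := a) (s := p - 1 + -σ) (b := β)
    (by linarith) ha hβ).const_mul (κ ^ (-σ))
  refine IntegrableOn.congr_fun h (fun x hx => ?_) measurableSet_Ioi
  have hx : 0 < x := hx
  rw [Real.rpow_add hx, Real.mul_rpow hκ.le hx.le, neg_mul]
  ring

/-- Mellin-Barnes representation of the Laplace-type integral of `(1 + κ x) ^ (-w)` against the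
weight `x ^ (p - 1) exp (-β x ^ a)`. -/
theorem integral_weight_mul_one_add_rpow_neg {p a β κ w σ : ℝ} (ha : 0 < a) (hβ : 0 < β)
    (hκ : 0 < κ) (hσ : 0 < σ) (hσw : σ < w) (hσp : σ < p) :
    ∫ x in Set.Ioi (0 : ℝ),
        ((x ^ (p - 1) * Real.exp (-(β * x ^ a)) * (1 + κ * x) ^ (-w) : ℝ) : ℂ) =
      (1 / (2 * Real.pi) : ℂ) / Complex.Gamma w *
        ∫ y : ℝ, Complex.Gamma (σ + y * Complex.I) * Complex.Gamma (w - (σ + y * Complex.I)) *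
          ((κ : ℂ) ^ (-(σ + y * Complex.I)) *
            ((1 / a : ℝ) * ((β : ℂ) ^ (-((p - (σ + y * Complex.I)) / a)) *
              Complex.Gamma ((p - (σ + y * Complex.I)) / a)))) := by
  let H : ℝ → ℂ := fun y =>
    Complex.Gamma (σ + y * Complex.I) * Complex.Gamma (w - (σ + y * Complex.I))
  let F : ℝ → ℝ → ℂ := fun x y =>
    ((x ^ (p - 1) * Real.exp (-(β * x ^ a)) : ℝ) : ℂ) *
      (((κ * x : ℝ) : ℂ) ^ (-(σ + y * Complex.I)) * H y)
  -- The modulus of `(κ x) ^ (-s)` does not depend on `y`. So `F` is an integrable function of `x`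
  -- times an integrable function of `y` times a unimodular phase, and Fubini applies.
  have hsplit : ∀ x ∈ Set.Ioi (0 : ℝ), ∀ y : ℝ, ((κ * x : ℝ) : ℂ) ^ (-(σ + y * Complex.I)) =
      (((κ * x) ^ (-σ) : ℝ) : ℂ) *
        Complex.exp ((-(y * Real.log (κ * x)) : ℝ) * Complex.I) := by
    intro x hx y
    have hx : 0 < κ * x := mul_pos hκ hx
    rw [Complex.ofReal_cpow_eq_exp hx, Real.rpow_def_of_pos hx, Complex.ofReal_exp,
      ← Complex.exp_add]
    congr 1
    push_cast
    ring
  have hint : Integrable (Function.uncurry F) ((volume.restrict (Set.Ioi 0)).prod volume) := by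
    have h0 : Integrable
        (fun x : ℝ => ((x ^ (p - 1) * Real.exp (-(β * x ^ a)) * (κ * x) ^ (-σ) : ℝ) : ℂ))
        (volume.restrict (Set.Ioi 0)) :=
      (integrableOn_rpow_mul_exp_neg_mul_rpow_mul_rpow ha hβ hκ hσp).ofReal
    have h1 := h0.mul_prod (Complex.integrable_Gamma_mul_Gamma_sub hσ hσw)
    have h2 := h1.bdd_mul (c := 1)
      (f := fun z : ℝ × ℝ => Complex.exp ((-(z.2 * Real.log (κ * z.1)) : ℝ) * Complex.I))
      (Measurable.aestronglyMeasurable (by fun_prop))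
      (Filter.Eventually.of_forall fun z => (Complex.norm_exp_ofReal_mul_I _).le)
    refine h2.congr ?_
    have : ∀ᵐ z : ℝ × ℝ ∂((volume.restrict (Set.Ioi 0)).prod volume), z.1 ∈ Set.Ioi (0 : ℝ) :=
      Measure.quasiMeasurePreserving_fst.ae (ae_restrict_mem measurableSet_Ioi)
    filter_upwards [this] with z hz
    simp only [F, Function.uncurry, hsplit z.1 hz z.2, H]
    push_cast
    ring
  have hL : ∫ x in Set.Ioi (0 : ℝ),
        ((x ^ (p - 1) * Real.exp (-(β * x ^ a)) * (1 + κ * x) ^ (-w) : ℝ) : ℂ) =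
      (1 / (2 * Real.pi) : ℂ) / Complex.Gamma w *
        ∫ x in Set.Ioi (0 : ℝ), ∫ y : ℝ, F x y := by
    rw [← integral_const_mul]
    refine setIntegral_congr_fun measurableSet_Ioi fun x hx => ?_
    rw [Complex.ofReal_mul, one_add_rpow_neg_eq_mellinBarnes hσ hσw (mul_pos hκ hx)]
    simp only [F, H]
    rw [integral_const_mul]
    ring
  rw [hL, integral_integral_swap hint]
  congr 1
  refine integral_congr_ae (Filter.Eventually.of_forall fun y => ?_)
  simp only
  -- The inner integral is the Mellin transform of `exp (-β x ^ a)` at `p - s`; this is where `σ <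
  -- p` is needed.
  rw [← mellin_exp_neg_mul_rpow ha hβ (by simpa using hσp), mellin, ← integral_const_mul,
    ← integral_const_mul]
  refine setIntegral_congr_fun measurableSet_Ioi fun x hx => ?_
  have hx : 0 < x := hx
  have hx0 : (x : ℂ) ≠ 0 := Complex.ofReal_ne_zero.mpr hx.ne'
  simp only [F, H, smul_eq_mul]
  rw [Complex.ofReal_mul κ x, Complex.mul_cpow_ofReal_nonneg hκ.le hx.le,
    show (p : ℂ) - (σ + y * Complex.I) - 1 = ((p - 1 : ℝ) : ℂ) + -(σ + y * Complex.I) by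
      push_cast; ring, Complex.cpow_add _ _ hx0, Complex.ofReal_mul (x ^ (p - 1)),
    Complex.ofReal_cpow hx.le]
  ring

/-! ### Reduction of the Meijer integrand. -/

theorem Complex.prod_Gamma_add_div_of_pos {m : ℕ} (hm : 0 < m) (s : ℂ) :
    ∏ k ∈ Finset.range m, Complex.Gamma (s + (k : ℂ) / (m : ℂ)) =
      ((√(2 * Real.pi) ^ (m - 1) * √(m : ℝ) : ℝ) : ℂ) *
        (Complex.exp (-(Real.log m * (m * s))) * Complex.Gamma (m * s)) := by
  obtain ⟨p, rfl⟩ : ∃ p, m = p + 1 := ⟨m - 1, by omega⟩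
  rw [Complex.prod_Gamma_add_div, Complex.ofReal_cpow_eq_exp (by positivity), one_div,
    Real.log_inv, Nat.add_sub_cancel]
  push_cast
  ring_nf

theorem prod_Gamma_lowerParams {α : ℕ} (hα : 0 < α) (μ : ℕ) (w : ℝ) (t : ℂ) :
    ∏ j : Fin (2 + α), Complex.Gamma (lowerParams α μ w j - t) =
      (Complex.Gamma (-2 * t) * (2 : ℂ) ^ (1 + 2 * t) * √Real.pi) *
      (((√(2 * Real.pi) ^ (α - 1) * √(α : ℝ) : ℝ) : ℂ) *
        (Complex.exp (-(Real.log α * (w - (α * μ / 2 + α * t)))) *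
          Complex.Gamma (w - (α * μ / 2 + α * t)))) := by
  have hα0 : (α : ℂ) ≠ 0 := Nat.cast_ne_zero.mpr hα.ne'
  rw [Fin.prod_univ_add]
  simp only [lowerParams, Fin.append_left, Fin.append_right]
  congr 1
  · rw [Fin.prod_univ_two]
    have h := Complex.Gamma_mul_Gamma_add_half (-t)
    simp only [paramDelta]
    have e1 : (((0 + ((1 : Fin 2) : ℕ)) / (2 : ℕ) : ℝ) : ℂ) - t = -t + 1 / 2 := by
      push_cast; simp; ring
    have e0 : (((0 + ((0 : Fin 2) : ℕ)) / (2 : ℕ) : ℝ) : ℂ) - t = -t := by simp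
    rw [e0, e1, h]
    ring_nf
  · have h := Complex.prod_Gamma_add_div_of_pos hα ((w - α * μ / 2) / α - t)
    have e : (α : ℂ) * ((w - α * μ / 2) / α - t) = w - (α * μ / 2 + α * t) := by
      field_simp
      ring
    rw [e] at h
    rw [← h, Finset.prod_range]
    refine Finset.prod_congr rfl fun k _ => ?_
    simp only [paramDelta]
    congr 1
    push_cast
    ring

theorem prod_Gamma_upperParams {α : ℕ} (hα : 0 < α) (μ : ℕ) (t : ℂ) :
    ∏ j : Fin α, Complex.Gamma (1 - upperParams α μ j + t) =
      ((√(2 * Real.pi) ^ (α - 1) * √(α : ℝ) : ℝ) : ℂ) *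
        (Complex.exp (-(Real.log α * (α * μ / 2 + α * t))) *
          Complex.Gamma (α * μ / 2 + α * t)) := by
  have hα0 : (α : ℂ) ≠ 0 := Nat.cast_ne_zero.mpr hα.ne'
  have h := Complex.prod_Gamma_add_div_of_pos hα ((μ : ℂ) / 2 + t)
  have e : (α : ℂ) * (μ / 2 + t) = α * μ / 2 + α * t := by ring
  rw [e] at h
  -- The upper list enters with a minus sign, so its terms appear in reverse: index `k` corresponds
  -- to the shift `(α - 1 - k) / α`.
  rw [← h, ← Finset.prod_range_reflect, Finset.prod_range]
  refine Finset.prod_congr rfl fun k _ => ?_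
  simp only [upperParams, paramDelta]
  have hk : (k : ℕ) ≤ α - 1 := by omega
  congr 1
  rw [Nat.cast_sub hk, Nat.cast_sub hα]
  push_cast
  field_simp
  ring

/-- With `s = αμ/2 + αt`, the multiplication formula contributes `α ^ (-(w - s))` and `α ^ (-s)`,
whose product `α ^ (-w)` is free of `t`; the `2 ^ (2t)` of the duplication formula cancels the `4 ^
(-t)` in `z ^ t`. -/
theorem meijerGIntegrand_alphaMu {α : ℕ} (hα : 0 < α) (μ : ℕ) (hμ : 0 < μ) {as ρ Ωs : ℝ}
    (has : 0 < as) (hρ : 0 < ρ) (hΩs : 0 < Ωs) (w : ℝ) (t : ℂ) :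
    meijerGIntegrand (2 + α) α (upperParams α μ) (lowerParams α μ w)
        (meijerArg α μ as ρ Ωs : ℂ) t =
      ((2 * √Real.pi * (2 * Real.pi) ^ (α - 1) * α * (α : ℝ) ^ (-w) : ℝ) : ℂ) *
        (Complex.Gamma (α * μ / 2 + α * t) * Complex.Gamma (w - (α * μ / 2 + α * t)) *
          (((as * ρ : ℝ) : ℂ) ^ (-(α * t)) *
            (((μ / Ωs ^ α : ℝ) : ℂ) ^ (2 * t) * Complex.Gamma (-2 * t)))) := by
  have hα' : (0 : ℝ) < α := by positivity
  have hκ : 0 < as * ρ := mul_pos has hρ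
  have hβ : (0 : ℝ) < μ / Ωs ^ α := by positivity
  have harg : meijerArg α μ as ρ Ωs = (μ / Ωs ^ α) ^ 2 / (2 ^ 2 * (as * ρ) ^ α) := by
    unfold meijerArg
    have := hκ.ne'
    rw [pow_mul', div_pow]
    field_simp
    norm_num
  have hz : 0 < meijerArg α μ as ρ Ωs := by rw [harg]; positivity
  have hlog : Real.log (meijerArg α μ as ρ Ωs) =
      2 * Real.log (μ / Ωs ^ α) - (2 * Real.log 2 + α * Real.log (as * ρ)) := by
    rw [harg, Real.log_div (by positivity) (by positivity), Real.log_mul (by positivity)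
      (by positivity), Real.log_pow, Real.log_pow, Real.log_pow]
    norm_num
  unfold meijerGIntegrand
  simp only [Fin.is_lt, if_true]
  rw [prod_Gamma_lowerParams hα, prod_Gamma_upperParams hα,
    show (2 : ℂ) = ((2 : ℝ) : ℂ) by norm_num]
  rw [Complex.ofReal_cpow_eq_exp hz, Complex.ofReal_cpow_eq_exp two_pos,
    Complex.ofReal_cpow_eq_exp hκ, Complex.ofReal_cpow_eq_exp hβ, hlog]
  have hpi : ((2 * Real.pi) ^ (α - 1) : ℝ) = √(2 * Real.pi) ^ (α - 1) * √(2 * Real.pi) ^ (α - 1) := by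
    rw [← mul_pow, Real.mul_self_sqrt (by positivity)]
  have hα2 : (α : ℝ) * (α : ℝ) ^ (-w) = √(α : ℝ) * √(α : ℝ) * Real.exp (-(Real.log α * w)) := by
    rw [Real.mul_self_sqrt hα'.le, Real.rpow_def_of_pos hα', mul_neg]
  have hexp : Complex.exp (Real.log 2 * (1 + (2 : ℝ) * t)) *
      (Complex.exp (-(Real.log α * (w - (α * μ / (2 : ℝ) + α * t)))) *
       Complex.exp (-(Real.log α * (α * μ / (2 : ℝ) + α * t)))) *
      Complex.exp ((2 * Real.log (μ / Ωs ^ α) - (2 * Real.log 2 + α * Real.log (as * ρ)) : ℝ) * t) =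
      2 * Complex.exp (-(Real.log α * w)) * (Complex.exp (Real.log (as * ρ) * -(α * t)) *
        Complex.exp (Real.log (μ / Ωs ^ α) * ((2 : ℝ) * t))) := by
    have h2 : (2 : ℂ) = Complex.exp (Real.log 2) := by
      rw [← Complex.ofReal_exp, Real.exp_log two_pos]; norm_num
    conv_rhs => rw [h2]
    simp only [← Complex.exp_add]
    congr 1
    push_cast
    ring
  rw [mul_assoc (_ * _ * _ : ℝ) (α : ℝ), hpi, hα2]
  push_cast at hexp ⊢
  linear_combination (√Real.pi * (√(2 * Real.pi) : ℂ) ^ (α - 1) * (√(2 * Real.pi) : ℂ) ^ (α - 1) *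
    (√(α : ℝ) : ℂ) * (√(α : ℝ) : ℂ) * Complex.Gamma (α * μ / 2 + α * t) *
    Complex.Gamma (w - (α * μ / 2 + α * t)) * Complex.Gamma (-2 * t)) * hexp

/-- Each list is increasing, so only its extreme entry binds: the first of each lower list and the
last of the upper one. For `σ = αμ/2 + αc` this reads `0 < σ < min (αμ/2) w`. -/
theorem meijerGSeparates_alphaMu_iff {α : ℕ} (hα : 0 < α) (μ : ℕ) (w c : ℝ) :
    MeijerGSeparates (2 + α) α (upperParams α μ) (lowerParams α μ w) c ↔
      c < 0 ∧ 0 < (α * μ : ℝ) / 2 + α * c ∧ (α * μ : ℝ) / 2 + α * c < w := by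
  have hα' : (0 : ℝ) < α := by positivity
  have hα1 : (1 : ℝ) ≤ α := by exact_mod_cast hα
  unfold MeijerGSeparates
  constructor
  · rintro ⟨h1, h2⟩
    refine ⟨?_, ?_, ?_⟩
    · have := h1 (Fin.castAdd α (0 : Fin 2)) (Fin.is_lt _)
      rw [lowerParams, Fin.append_left, paramDelta, Complex.ofReal_re] at this
      simpa using this
    · have := h2 ⟨α - 1, by omega⟩ (by simp; omega)
      rw [upperParams, paramDelta, Complex.ofReal_re] at this
      simp only [Nat.cast_sub hα] at this
      rw [sub_lt_iff_lt_add, div_lt_iff₀ hα'] at this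
      push_cast at this
      linarith
    · have := h1 (Fin.natAdd 2 ⟨0, hα⟩) (Fin.is_lt _)
      rw [lowerParams, Fin.append_right, paramDelta, Complex.ofReal_re, lt_div_iff₀ hα'] at this
      simp only [Nat.cast_zero] at this
      linarith
  · rintro ⟨h0, h1, h2⟩
    refine ⟨fun j _ => ?_, fun j _ => ?_⟩
    · rw [lowerParams]
      refine Fin.addCases (fun k => ?_) (fun k => ?_) j
      · rw [Fin.append_left, paramDelta, Complex.ofReal_re]
        exact h0.trans_le (by positivity)
      · rw [Fin.append_right, paramDelta, Complex.ofReal_re, lt_div_iff₀ hα']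
        have : (0 : ℝ) ≤ (k : ℕ) := Nat.cast_nonneg _
        linarith
    · rw [upperParams, paramDelta, Complex.ofReal_re, sub_lt_iff_lt_add, div_lt_iff₀ hα']
      have : ((j : ℕ) : ℝ) + 1 ≤ α := by exact_mod_cast j.2
      linarith

theorem exists_meijerGSeparates_alphaMu {α μ : ℕ} (hα : 0 < α) (hμ : 0 < μ) {w : ℝ} (hw : 0 < w) :
    ∃ c, MeijerGSeparates (2 + α) α (upperParams α μ) (lowerParams α μ w) c := by
  have hα' : (0 : ℝ) < α := by positivity
  have hp : (0 : ℝ) < (α * μ : ℝ) / 2 := by positivity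
  obtain ⟨σ, h0, h1⟩ := exists_between (lt_min hp hw)
  refine ⟨(σ - (α * μ : ℝ) / 2) / α, (meijerGSeparates_alphaMu_iff hα μ w _).mpr ?_⟩
  rw [mul_div_cancel₀ _ hα'.ne', add_sub_cancel]
  exact ⟨div_neg_of_neg_of_pos (by linarith [h1.trans_le (min_le_left _ _)]) hα', h0,
    h1.trans_le (min_le_right _ _)⟩

theorem integrable_alphaMu_kernel {α μ : ℕ} (hα : 0 < α) {κ β w c : ℝ} (hκ : 0 < κ) (hβ : 0 < β)
    (hc : MeijerGSeparates (2 + α) α (upperParams α μ) (lowerParams α μ w) c) :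
    Integrable fun y : ℝ =>
        Complex.Gamma (α * μ / 2 + α * (c + y * Complex.I)) *
          Complex.Gamma (w - (α * μ / 2 + α * (c + y * Complex.I))) *
          ((κ : ℂ) ^ (-(α * (c + y * Complex.I) : ℂ)) *
            ((β : ℂ) ^ (2 * (c + y * Complex.I)) * Complex.Gamma (-2 * (c + y * Complex.I)))) := by
  obtain ⟨h0, h1, h2⟩ := (meijerGSeparates_alphaMu_iff hα μ w c).mp hc
  have hα' : (α : ℝ) ≠ 0 := by positivity
  have hI := (Complex.integrable_Gamma_mul_Gamma_sub h1 h2).comp_mul_left' hα'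
  have hκ0 : (κ : ℂ) ≠ 0 := Complex.ofReal_ne_zero.mpr hκ.ne'
  have hβ0 : (β : ℂ) ≠ 0 := Complex.ofReal_ne_zero.mpr hβ.ne'
  have e2 : ∀ y : ℝ, (-2 * (c + y * Complex.I) : ℂ) =
      ((-2 * c : ℝ) : ℂ) + ((-2 * y : ℝ) : ℂ) * Complex.I := by intro y; push_cast; ring
  have hcont : Continuous fun y : ℝ => (κ : ℂ) ^ (-(α * (c + y * Complex.I) : ℂ)) *
      ((β : ℂ) ^ (2 * (c + y * Complex.I)) * Complex.Gamma (-2 * (c + y * Complex.I))) := by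
    simp only [e2]
    refine Continuous.mul ?_ (Continuous.mul ?_ (Complex.continuous_Gamma_vertical (by linarith) _))
    · exact Continuous.const_cpow (by fun_prop) (Or.inl hκ0)
    · exact Continuous.const_cpow (by fun_prop) (Or.inl hβ0)
  -- The product of the first two Gammas is integrable along the line, and the remaining factors are
  -- bounded there because `Re (-2t) = -2c > 0`.
  refine (hI.bdd_mul (c := κ ^ (-(α * c)) * (β ^ (2 * c) * Real.Gamma (-2 * c)))
    hcont.aestronglyMeasurable (Filter.Eventually.of_forall fun y => ?_)).congr
    (Filter.Eventually.of_forall fun y => ?_)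
  · rw [norm_mul, norm_mul, Complex.norm_cpow_eq_rpow_re_of_pos hκ,
      Complex.norm_cpow_eq_rpow_re_of_pos hβ]
    have hr : (-2 * (c + y * Complex.I) : ℂ).re = -2 * c := by simp
    have hG := Complex.norm_Gamma_le_of_re_pos (s := -2 * (c + y * Complex.I)) (by rw [hr]; linarith)
    rw [hr] at hG
    have r1 : (-(α * (c + y * Complex.I)) : ℂ).re = -(α * c) := by simp
    have r2 : (2 * (c + y * Complex.I) : ℂ).re = 2 * c := by simp
    rw [r1, r2]
    gcongr
  · simp only
    push_cast
    rw [mul_comm]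
    ring_nf

/-- The Mellin-Barnes line integral in terms of the `α`-`μ` weighted integral of
`(1 + κ x) ^ (-w)`. -/
theorem integral_alphaMu_weight {α μ : ℕ} (hα : 0 < α) {κ β w c : ℝ} (hκ : 0 < κ) (hβ : 0 < β)
    (hc : MeijerGSeparates (2 + α) α (upperParams α μ) (lowerParams α μ w) c) :
    ∫ x in Set.Ioi (0 : ℝ),
        ((x ^ ((α * μ : ℝ) / 2 - 1) * Real.exp (-(β * x ^ ((α : ℝ) / 2))) *
          (1 + κ * x) ^ (-w) : ℝ) : ℂ) =
      (1 / (2 * Real.pi) : ℂ) / Complex.Gamma w * (2 * (κ ^ (-((α * μ : ℝ) / 2)) : ℝ)) *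
        ∫ y : ℝ, Complex.Gamma (α * μ / 2 + α * (c + y * Complex.I)) *
          Complex.Gamma (w - (α * μ / 2 + α * (c + y * Complex.I))) *
          ((κ : ℂ) ^ (-(α * (c + y * Complex.I) : ℂ)) *
            ((β : ℂ) ^ (2 * (c + y * Complex.I)) * Complex.Gamma (-2 * (c + y * Complex.I)))) := by
  obtain ⟨h0, h1, h2⟩ := (meijerGSeparates_alphaMu_iff hα μ w c).mp hc
  have hα' : (0 : ℝ) < α := by positivity
  have hαc : (α : ℂ) ≠ 0 := Nat.cast_ne_zero.mpr hα.ne'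
  have hκ0 : (κ : ℂ) ≠ 0 := Complex.ofReal_ne_zero.mpr hκ.ne'
  rw [integral_weight_mul_one_add_rpow_neg (by positivity) hβ hκ h1 h2
    (by nlinarith [mul_neg_of_pos_of_neg hα' h0])]
  rw [mul_assoc]
  congr 1
  rw [← integral_const_mul]
  -- Rescaling `y` to `α y` passes from the line of `s` to that of `t`, where `s = αμ/2 + αt`.
  have hs := Measure.integral_comp_mul_left (fun y : ℝ =>
    Complex.Gamma (((α * μ : ℝ) / 2 + α * c : ℝ) + y * Complex.I) *
      Complex.Gamma (w - (((α * μ : ℝ) / 2 + α * c : ℝ) + y * Complex.I)) *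
      ((κ : ℂ) ^ (-(((α * μ : ℝ) / 2 + α * c : ℝ) + y * Complex.I)) *
        ((1 / ((α : ℝ) / 2) : ℝ) *
          ((β : ℂ) ^ (-((((α * μ : ℝ) / 2 : ℝ) -
            (((α * μ : ℝ) / 2 + α * c : ℝ) + y * Complex.I)) / ((α : ℝ) / 2 : ℝ))) *
            Complex.Gamma ((((α * μ : ℝ) / 2 : ℝ) -
              (((α * μ : ℝ) / 2 + α * c : ℝ) + y * Complex.I)) / ((α : ℝ) / 2 : ℝ)))))) (α : ℝ)
  rw [abs_of_pos (inv_pos.mpr hα'), eq_inv_smul_iff₀ hα'.ne', ← integral_smul] at hs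
  rw [← hs]
  refine integral_congr_ae (Filter.Eventually.of_forall fun y => ?_)
  have e1 : ((((α * μ : ℝ) / 2 + α * c : ℝ) : ℂ) + ((α * y : ℝ) : ℂ) * Complex.I) =
      α * μ / 2 + α * (c + y * Complex.I) := by push_cast; ring
  have e2 : ((((α * μ : ℝ) / 2 : ℝ) : ℂ) - (α * μ / 2 + α * (c + y * Complex.I))) /
      ((α : ℝ) / 2 : ℝ) = -2 * (c + y * Complex.I) := by
    push_cast
    field_simp
    ring
  have e3 : (κ : ℂ) ^ (-(α * μ / 2 + α * (c + y * Complex.I)) : ℂ) =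
      (κ ^ (-((α * μ : ℝ) / 2)) : ℝ) * (κ : ℂ) ^ (-(α * (c + y * Complex.I)) : ℂ) := by
    rw [Complex.ofReal_cpow hκ.le, ← Complex.cpow_add _ _ hκ0]
    congr 1
    push_cast
    ring
  simp only [e1, e2, e3, Complex.real_smul]
  rw [show (-(-2 * (c + y * Complex.I)) : ℂ) = 2 * (c + y * Complex.I) by ring]
  push_cast
  field_simp

/-! ### The gain law and the closed form. -/

theorem measurable_alphaMuGainPDF (α μ : ℕ) (Ωs : ℝ) : Measurable (alphaMuGainPDF α μ Ωs) := by
  unfold alphaMuGainPDF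
  exact Measurable.ite measurableSet_Ioi (by fun_prop) measurable_const

theorem integral_alphaMuGainLaw (α μ : ℕ) {Ωs : ℝ} (hΩs : 0 < Ωs) (f : ℝ → ℝ) :
    ∫ x, f x ∂alphaMuGainLaw α μ Ωs =
      (α * (μ : ℝ) ^ μ) / (2 * Ωs ^ (α * μ) * Real.Gamma μ) *
        ∫ x in Set.Ioi (0 : ℝ), x ^ ((α * μ : ℝ) / 2 - 1) *
          Real.exp (-(μ / Ωs ^ α * x ^ ((α : ℝ) / 2))) * f x := by
  rw [alphaMuGainLaw, integral_withDensity_eq_integral_toReal_smul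
    (measurable_alphaMuGainPDF α μ Ωs).ennreal_ofReal
    (Filter.Eventually.of_forall fun _ => ENNReal.ofReal_lt_top), ← integral_const_mul,
    ← integral_indicator measurableSet_Ioi]
  congr 1 with x
  by_cases hx : 0 < x
  · have hΓ : 0 ≤ Real.Gamma μ := Real.Gamma_nonneg_of_nonneg (Nat.cast_nonneg _)
    rw [Set.indicator_of_mem (Set.mem_Ioi.mpr hx), alphaMuGainPDF, if_pos hx,
      ENNReal.toReal_ofReal (by positivity), smul_eq_mul, div_mul_eq_mul_div (μ : ℝ)]
    ring
  · rw [Set.indicator_of_notMem (by simpa using hx), alphaMuGainPDF, if_neg hx]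
    simp

theorem ae_pos_alphaMuGainLaw (α μ : ℕ) (Ωs : ℝ) : ∀ᵐ x ∂alphaMuGainLaw α μ Ωs, 0 < x := by
  rw [alphaMuGainLaw, ae_withDensity_iff (measurable_alphaMuGainPDF α μ Ωs).ennreal_ofReal]
  refine Filter.Eventually.of_forall fun x hx => ?_
  by_contra h
  exact hx (by simp [alphaMuGainPDF, h])

section ClosedForm

variable {α μ : ℕ} (hα : 0 < α) (hμ : 0 < μ) {as ρ Ωs : ℝ} (has : 0 < as) (hρ : 0 < ρ)
  (hΩs : 0 < Ωs) {w c : ℝ}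
include hα hμ has hρ hΩs

theorem integrable_meijerGIntegrand_alphaMu
    (hc : MeijerGSeparates (2 + α) α (upperParams α μ) (lowerParams α μ w) c) :
    Integrable (fun y : ℝ => meijerGIntegrand (2 + α) α (upperParams α μ) (lowerParams α μ w)
      (meijerArg α μ as ρ Ωs : ℂ) (c + y * Complex.I)) := by
  simp only [meijerGIntegrand_alphaMu hα μ hμ has hρ hΩs]
  exact (integrable_alphaMu_kernel hα (mul_pos has hρ) (by positivity) hc).const_mul _

/-- The closed form, with the `G`-function evaluated along any separating line. -/
theorem integral_alphaMuGainLaw_eq_meijerGLine (hw : 0 < w)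
    (hc : MeijerGSeparates (2 + α) α (upperParams α μ) (lowerParams α μ w) c) :
    ((∫ x, (1 + as * ρ * x) ^ (-w) ∂alphaMuGainLaw α μ Ωs : ℝ) : ℂ) =
      (((α : ℝ) ^ w * (μ : ℝ) ^ μ : ℝ) : ℂ) *
        meijerGLine (2 + α) α (upperParams α μ) (lowerParams α μ w)
          (meijerArg α μ as ρ Ωs : ℂ) c /
      ((√2 * (2 * Real.pi) ^ ((α : ℝ) - 1 / 2) * Ωs ^ (α * μ) * Real.Gamma μ * Real.Gamma w *
        (as * ρ) ^ ((α * μ : ℝ) / 2) : ℝ) : ℂ) := by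
  have hκ : 0 < as * ρ := mul_pos has hρ
  have hα' : (0 : ℝ) < α := by positivity
  have hpi : (0 : ℝ) < 2 * Real.pi := by positivity
  have hΓμ : 0 < Real.Gamma μ := Real.Gamma_pos_of_pos (by positivity)
  have hΓw : 0 < Real.Gamma w := Real.Gamma_pos_of_pos hw
  rw [integral_alphaMuGainLaw α μ hΩs, Complex.ofReal_mul, ← integral_complex_ofReal,
    integral_alphaMu_weight hα hκ (by positivity) hc, meijerGLine]
  simp only [meijerGIntegrand_alphaMu hα μ hμ has hρ hΩs]
  rw [integral_const_mul, Complex.Gamma_ofReal]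
  generalize (∫ y : ℝ, Complex.Gamma (α * μ / 2 + α * (c + y * Complex.I)) *
    Complex.Gamma (w - (α * μ / 2 + α * (c + y * Complex.I))) * _) = J
  have hconst : (α * (μ : ℝ) ^ μ) / (2 * Ωs ^ (α * μ) * Real.Gamma μ) *
      (1 / (2 * Real.pi) / Real.Gamma w * (2 * (as * ρ) ^ (-((α * μ : ℝ) / 2)))) =
      ((α : ℝ) ^ w * (μ : ℝ) ^ μ) * (1 / (2 * Real.pi) *
        (2 * √Real.pi * (2 * Real.pi) ^ (α - 1) * α * (α : ℝ) ^ (-w))) /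
      (√2 * (2 * Real.pi) ^ ((α : ℝ) - 1 / 2) * Ωs ^ (α * μ) * Real.Gamma μ * Real.Gamma w *
        (as * ρ) ^ ((α * μ : ℝ) / 2)) := by
    have e1 : (2 * Real.pi) ^ ((α : ℝ) - 1 / 2) = (2 * Real.pi) ^ (α - 1) * (√2 * √Real.pi) := by
      rw [← Real.sqrt_mul (by norm_num), Real.sqrt_eq_rpow, ← Real.rpow_natCast,
        ← Real.rpow_add hpi, Nat.cast_sub hα]
      congr 1
      push_cast
      ring
    have e2 : √(2 : ℝ) * √2 = 2 := Real.mul_self_sqrt (by norm_num)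
    rw [e1, Real.rpow_neg hκ.le, Real.rpow_neg hα'.le]
    have p1 : (0 : ℝ) < (as * ρ) ^ ((α * μ : ℝ) / 2) := by positivity
    have p2 : (0 : ℝ) < (α : ℝ) ^ w := by positivity
    generalize (as * ρ) ^ ((α * μ : ℝ) / 2) = X at *
    generalize (α : ℝ) ^ w = Y at *
    have p3 : (2 * Real.pi) ^ (α - 1) ≠ 0 := by positivity
    generalize (2 * Real.pi) ^ (α - 1) = Z at *
    have p4 : √Real.pi ≠ 0 := by positivity
    have p5 : √(2 : ℝ) ≠ 0 := by positivity
    field_simp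
    rw [sq, e2]
  have h := congrArg (fun r : ℝ => (r : ℂ) * J) hconst
  push_cast at h ⊢
  calc _ = _ := by ring
    _ = _ := h
    _ = _ := by ring

/-- Both lines represent the same expectation, with the same nonzero prefactor. -/
theorem meijerGLine_alphaMu_eq {c' : ℝ} (hw : 0 < w)
    (hc : MeijerGSeparates (2 + α) α (upperParams α μ) (lowerParams α μ w) c)
    (hc' : MeijerGSeparates (2 + α) α (upperParams α μ) (lowerParams α μ w) c') :
    meijerGLine (2 + α) α (upperParams α μ) (lowerParams α μ w)
        (meijerArg α μ as ρ Ωs : ℂ) c =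
      meijerGLine (2 + α) α (upperParams α μ) (lowerParams α μ w)
        (meijerArg α μ as ρ Ωs : ℂ) c' := by
  have hκ : 0 < as * ρ := mul_pos has hρ
  have hΓμ : 0 < Real.Gamma μ := Real.Gamma_pos_of_pos (by positivity)
  have hΓw : 0 < Real.Gamma w := Real.Gamma_pos_of_pos hw
  have h := (integral_alphaMuGainLaw_eq_meijerGLine hα hμ has hρ hΩs hw hc).symm.trans
    (integral_alphaMuGainLaw_eq_meijerGLine hα hμ has hρ hΩs hw hc')
  rw [div_left_inj' (Complex.ofReal_ne_zero.mpr (by positivity))] at h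
  exact mul_left_cancel₀ (Complex.ofReal_ne_zero.mpr (by positivity)) h

theorem meijerG_alphaMu_eq_meijerGLine (hw : 0 < w)
    (hc : MeijerGSeparates (2 + α) α (upperParams α μ) (lowerParams α μ w) c) :
    meijerG (2 + α) α (upperParams α μ) (lowerParams α μ w) (meijerArg α μ as ρ Ωs : ℂ) =
      meijerGLine (2 + α) α (upperParams α μ) (lowerParams α μ w)
        (meijerArg α μ as ρ Ωs : ℂ) c := by
  have h : ∃ c, MeijerGSeparates (2 + α) α (upperParams α μ) (lowerParams α μ w) c := ⟨c, hc⟩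
  rw [meijerG, dif_pos h]
  exact meijerGLine_alphaMu_eq hα hμ has hρ hΩs hw h.choose_spec hc

theorem integral_alphaMuGainLaw_eq_mellinClosedForm (hw : 0 < w) :
    ((∫ x, (1 + as * ρ * x) ^ (-w) ∂alphaMuGainLaw α μ Ωs : ℝ) : ℂ) =
      mellinClosedForm α μ as ρ Ωs w := by
  obtain ⟨c, hc⟩ := exists_meijerGSeparates_alphaMu hα hμ hw
  rw [integral_alphaMuGainLaw_eq_meijerGLine hα hμ has hρ hΩs hw hc, mellinClosedForm,
    meijerG_alphaMu_eq_meijerGLine hα hμ has hρ hΩs hw hc]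

end ClosedForm

/-! ### The Mellin transform of `φ_s`. -/

theorem varpi_pos {N : ℕ} (hN : 0 < N) {S : ℝ} (hS : 0 < S) : 0 < varpi N S := by
  have := Real.log_pos one_lt_two
  unfold varpi
  positivity

theorem phiStrong_rpow_neg (N : ℕ) {as ρ x : ℝ} (h : 0 ≤ 1 + as * ρ * x) (S : ℝ) :
    phiStrong N as ρ x ^ (-S) = (1 + as * ρ * x) ^ (-varpi N S) := by
  rw [phiStrong, ← Real.rpow_mul h, varpi]
  congr 1
  ring

theorem measurable_phiStrong (N : ℕ) (as ρ : ℝ) : Measurable (phiStrong N as ρ) := by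
  unfold phiStrong
  fun_prop

section Gain

variable {W : Type*} [MeasurableSpace W] {P : Measure W} {α μ N : ℕ} {as ρ Ωs : ℝ}
  (has : 0 < as) (hρ : 0 < ρ) {g : W → ℝ} (hg : HasLaw g (alphaMuGainLaw α μ Ωs) P)
include hg

theorem ae_pos_of_hasLaw_alphaMuGainLaw : ∀ᵐ ω ∂P, 0 < g ω :=
  (hg.ae_iff (p := fun x => 0 < x) measurableSet_Ioi.mem).mpr (ae_pos_alphaMuGainLaw α μ Ωs)

include has hρ

theorem ae_phiStrong_rpow_neg (S : ℝ) :
    ∀ᵐ ω ∂P, phiStrong N as ρ (g ω) ^ (-S) = (1 + as * ρ * g ω) ^ (-varpi N S) := by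
  filter_upwards [ae_pos_of_hasLaw_alphaMuGainLaw hg] with ω hω
  exact phiStrong_rpow_neg N (by positivity) S

theorem integrable_phiStrong_rpow_neg [IsFiniteMeasure P] {S : ℝ} (hS : 0 < S) :
    Integrable (fun ω => phiStrong N as ρ (g ω) ^ (-S)) P := by
  refine Integrable.of_bound (C := 1) ?_ ?_
  · exact (((measurable_phiStrong N as ρ).pow_const (-S)).comp_aemeasurable
      hg.aemeasurable).aestronglyMeasurable
  · filter_upwards [ae_pos_of_hasLaw_alphaMuGainLaw hg] with ω hω
    have h1 : 1 ≤ 1 + as * ρ * g ω := by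
      have : 0 < as * ρ * g ω := by positivity
      linarith
    have h2 : 1 ≤ phiStrong N as ρ (g ω) :=
      Real.one_le_rpow h1 (div_nonneg (Nat.cast_nonneg _) (Real.log_nonneg one_le_two))
    rw [Real.norm_of_nonneg (by positivity)]
    exact Real.rpow_le_one_of_one_le_of_nonpos h2 (by linarith)

theorem mellinRV_phiStrong (S : ℝ) :
    mellinRV P (fun ω => phiStrong N as ρ (g ω)) (1 - S) =
      ∫ ω, (1 + as * ρ * g ω) ^ (-varpi N S) ∂P := by
  rw [mellinRV, show 1 - S - 1 = -S by ring]
  exact integral_congr_ae (ae_phiStrong_rpow_neg has hρ hg S)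

theorem mellinRV_phiStrong_eq_mellinClosedForm (hα : 0 < α) (hμ : 0 < μ) (hN : 0 < N)
    (hΩs : 0 < Ωs) {S : ℝ} (hS : 0 < S) :
    (mellinRV P (fun ω => phiStrong N as ρ (g ω)) (1 - S) : ℂ) =
      mellinClosedForm α μ as ρ Ωs (varpi N S) := by
  rw [mellinRV_phiStrong has hρ hg,
    ← integral_alphaMuGainLaw_eq_mellinClosedForm hα hμ has hρ hΩs (varpi_pos hN hS),
    ← hg.integral_comp (f := fun x => (1 + as * ρ * x) ^ (-varpi N S))
      (Measurable.aestronglyMeasurable (by fun_prop))]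
  rfl

end Gain

/-! ### Sample paths of the queue. -/

theorem cumulative_zero_succ (x : ℕ → ℝ) (T : ℕ) :
    cumulative x 0 (T + 1) = cumulative x 0 T + x T := by
  rw [cumulative, cumulative, Finset.sum_Ico_succ_top (Nat.zero_le T)]

theorem cumulative_departure (arr srv : ℕ → ℝ) (T : ℕ) :
    cumulative (departure arr srv) 0 T = cumulative arr 0 T - backlog arr srv T := by
  induction T with
  | zero => simp [cumulative, backlog]
  | succ T ih =>
    rw [cumulative_zero_succ, cumulative_zero_succ, ih, departure, backlog]
    rcases le_total (backlog arr srv T + arr T) (srv T) with h | h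
    · rw [min_eq_left h, max_eq_right (by linarith)]
      ring
    · rw [min_eq_right h, max_eq_left (by linarith)]
      ring

/-- Take for `τ` the last time the truncation at `0` acted (or `0`): from then on the recursion is a
plain sum. -/
theorem exists_backlog_eq (arr srv : ℕ → ℝ) (T : ℕ) :
    ∃ τ ≤ T, backlog arr srv T = cumulative arr τ T - cumulative srv τ T := by
  induction T with
  | zero => exact ⟨0, le_rfl, by simp [cumulative, backlog]⟩
  | succ T ih =>
    obtain ⟨τ, hτ, h⟩ := ih
    rcases le_total (backlog arr srv T + arr T - srv T) 0 with h0 | h0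
    · exact ⟨T + 1, le_rfl, by rw [backlog, max_eq_right h0]; simp [cumulative]⟩
    · refine ⟨τ, hτ.trans (Nat.le_succ T), ?_⟩
      rw [backlog, max_eq_left h0, h]
      simp only [cumulative]
      rw [Finset.sum_Ico_succ_top hτ, Finset.sum_Ico_succ_top hτ]
      ring

theorem cumulative_const (lam : ℝ) {τ T : ℕ} (h : τ ≤ T) :
    cumulative (fun _ => lam) τ T = lam * ((T : ℝ) - τ) := by
  simp only [cumulative, Finset.sum_const, Nat.card_Ico, nsmul_eq_mul, Nat.cast_sub h]
  ring

/-- A delay violation forces the service over some window to fall short of the arrivals. -/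
theorem exists_cumulative_lt_of_lt_queueDelay {lam : ℝ} (hlam : 0 ≤ lam) {srv : ℕ → ℝ}
    (hsrv : ∀ k, 0 ≤ srv k) {t θ : ℕ} (h : (θ : ℕ∞) < queueDelay (fun _ => lam) srv t) :
    ∃ τ < t, cumulative srv τ (t + θ) ≤ lam * ((t : ℝ) - τ) := by
  have hlt : cumulative (departure (fun _ => lam) srv) 0 (t + θ) <
      cumulative (fun _ => lam) 0 t := by
    by_contra! hc
    exact absurd h (not_lt.mpr (iInf₂_le θ hc))
  obtain ⟨τ, hτ, hb⟩ := exists_backlog_eq (fun _ => lam) srv (t + θ)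
  rw [cumulative_departure, hb, cumulative_const _ (Nat.zero_le _),
    cumulative_const _ (Nat.zero_le _), cumulative_const _ hτ] at hlt
  have hle : cumulative srv τ (t + θ) < lam * ((t : ℝ) - τ) := by
    simp only [Nat.cast_zero, sub_zero] at hlt
    linarith
  -- For `τ ≥ t` the right side would be nonpositive, yet it strictly exceeds a nonnegative service.
  refine ⟨τ, ?_, hle.le⟩
  by_contra! hc
  have h1 : 0 ≤ cumulative srv τ (t + θ) := Finset.sum_nonneg fun k _ => hsrv k
  have h2 : (t : ℝ) ≤ τ := by exact_mod_cast hc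
  nlinarith

/-! ### The delay bound. -/

theorem serviceStrong_nonneg (N : ℕ) {as ρ x : ℝ} (h : 0 ≤ as * ρ * x) :
    0 ≤ serviceStrong N as ρ x :=
  mul_nonneg (Nat.cast_nonneg _) (Real.logb_nonneg one_lt_two (by linarith))

theorem measurable_serviceStrong (N : ℕ) (as ρ : ℝ) : Measurable (serviceStrong N as ρ) := by
  unfold serviceStrong Real.logb
  fun_prop

theorem exp_neg_mul_serviceStrong (N : ℕ) {as ρ x : ℝ} (h : 0 < 1 + as * ρ * x) (S : ℝ) :
    Real.exp (-S * serviceStrong N as ρ x) = phiStrong N as ρ x ^ (-S) := by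
  rw [phiStrong, ← Real.rpow_mul h.le, Real.rpow_def_of_pos h, serviceStrong, Real.logb]
  congr 1
  ring

/-- With `j = t - τ` running from `1` to `t`, the summand is `M ^ θ (e M) ^ j`, so a geometric
series dominates. -/
theorem sum_pow_sub_mul_pow_le {M e : ℝ} (hM : 0 ≤ M) (he : 0 ≤ e) (h : e * M < 1) (t θ : ℕ) :
    ∑ τ ∈ Finset.range t, e ^ (t - τ) * M ^ (t + θ - τ) ≤ M ^ θ / (1 - e * M) := by
  have hq : 0 ≤ e * M := mul_nonneg he hM
  have h1 : ∑ τ ∈ Finset.range t, e ^ (t - τ) * M ^ (t + θ - τ) =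
      M ^ θ * (e * M * ∑ j ∈ Finset.range t, (e * M) ^ j) := by
    rw [← Finset.sum_range_reflect (fun j => (e * M) ^ j), Finset.mul_sum, Finset.mul_sum]
    refine Finset.sum_congr rfl fun τ hτ => ?_
    have hτ := Finset.mem_range.mp hτ
    rw [← pow_succ', show t - 1 - τ + 1 = t - τ by omega, mul_pow,
      show t + θ - τ = θ + (t - τ) by omega, pow_add]
    ring
  rw [h1, div_eq_mul_inv]
  refine mul_le_mul_of_nonneg_left ?_ (pow_nonneg hM θ)
  have h2 := mul_neg_geom_sum (e * M) t
  rw [← one_div, le_div_iff₀ (by linarith)]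
  have h3 : 0 ≤ (e * M) ^ t := pow_nonneg hq t
  calc _ = e * M * ((1 - e * M) * ∑ j ∈ Finset.range t, (e * M) ^ j) := by ring
    _ = e * M * (1 - (e * M) ^ t) := by rw [h2]
    _ ≤ 1 := by nlinarith

section Delay

variable {W : Type*} [MeasurableSpace W] {P : Measure W}
  {α μ N : ℕ} {as ρ Ωs : ℝ} (has : 0 < as) (hρ : 0 < ρ) {g : ℕ → W → ℝ}
  (hg : ∀ k, HasLaw (g k) (alphaMuGainLaw α μ Ωs) P)
include has hρ hg

theorem ae_serviceStrong_nonneg : ∀ᵐ ω ∂P, ∀ k, 0 ≤ serviceStrong N as ρ (g k ω) := by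
  rw [ae_all_iff]
  intro k
  filter_upwards [ae_pos_of_hasLaw_alphaMuGainLaw (hg k)] with ω hω
  exact serviceStrong_nonneg N (by positivity)

theorem mgf_serviceStrong (k : ℕ) (S : ℝ) :
    mgf (fun ω => serviceStrong N as ρ (g k ω)) P (-S) =
      mellinRV P (fun ω => phiStrong N as ρ (g k ω)) (1 - S) := by
  rw [mgf, mellinRV, show 1 - S - 1 = -S by ring]
  refine integral_congr_ae ?_
  filter_upwards [ae_pos_of_hasLaw_alphaMuGainLaw (hg k)] with ω hω
  exact exp_neg_mul_serviceStrong N (by positivity) S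

variable [IsProbabilityMeasure P]

/-- Chernoff bound for the service offered in a window of slots. -/
theorem measure_cumulative_serviceStrong_le (hind : iIndepFun g P) {S M : ℝ} (hS : 0 < S)
    (hM : ∀ k, mellinRV P (fun ω => phiStrong N as ρ (g k ω)) (1 - S) = M)
    (τ T : ℕ) (ε : ℝ) :
    P {ω | cumulative (fun k => serviceStrong N as ρ (g k ω)) τ T ≤ ε} ≤
      ENNReal.ofReal (Real.exp (S * ε) * M ^ (T - τ)) := by
  have hmeas : ∀ k, AEMeasurable (fun ω => serviceStrong N as ρ (g k ω)) P := fun k =>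
    (measurable_serviceStrong N as ρ).comp_aemeasurable (hg k).aemeasurable
  have hind' : iIndepFun (fun k ω => serviceStrong N as ρ (g k ω)) P :=
    hind.comp (fun _ => serviceStrong N as ρ) fun _ => measurable_serviceStrong N as ρ
  have hmgf := hind'.mgf_sum₀ (t := -S) hmeas (Finset.Ico τ T)
  simp only [mgf_serviceStrong has hρ hg, hM, Finset.prod_const, Nat.card_Ico] at hmgf
  have hint : Integrable (fun ω => Real.exp
      (-S * (∑ k ∈ Finset.Ico τ T, fun ω => serviceStrong N as ρ (g k ω)) ω)) P := by
    refine Integrable.of_bound (C := 1) ?_ ?_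
    · exact ((Finset.aemeasurable_sum _ fun k _ => hmeas k).const_mul
        (-S)).exp.aestronglyMeasurable
    · filter_upwards [ae_serviceStrong_nonneg (N := N) has hρ hg] with ω hω
      rw [Real.norm_of_nonneg (Real.exp_pos _).le, Real.exp_le_one_iff, Finset.sum_apply]
      have := Finset.sum_nonneg fun k (_ : k ∈ Finset.Ico τ T) => hω k
      nlinarith
  have h := measure_le_le_exp_mul_mgf ε (by linarith) hint
  rw [hmgf, neg_neg] at h
  simp only [Finset.sum_apply] at h
  rw [← ofReal_measureReal]
  exact ENNReal.ofReal_le_ofReal h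

/-- Union bound over the start `τ` of the window, with the Chernoff bound for each `τ`. -/
theorem measure_lt_queueDelay_le (hind : iIndepFun g P) {S M lam : ℝ} (hS : 0 < S)
    (hlam : 0 ≤ lam) (hM : ∀ k, mellinRV P (fun ω => phiStrong N as ρ (g k ω)) (1 - S) = M)
    (hlt : Real.exp (lam * S) * M < 1) (t θ : ℕ) :
    P {ω | (θ : ℕ∞) <
        queueDelay (fun _ => lam) (fun k => serviceStrong N as ρ (g k ω)) t} ≤
      ENNReal.ofReal (M ^ θ / (1 - Real.exp (lam * S) * M)) := by
  have hM0 : 0 ≤ M := by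
    rw [← hM 0, ← mgf_serviceStrong has hρ hg]
    exact mgf_nonneg
  calc P {ω | (θ : ℕ∞) <
        queueDelay (fun _ => lam) (fun k => serviceStrong N as ρ (g k ω)) t}
      ≤ P (⋃ τ ∈ Finset.range t, {ω | cumulative (fun k => serviceStrong N as ρ (g k ω)) τ
          (t + θ) ≤ lam * ((t : ℝ) - τ)}) := by
        -- The inclusion holds only almost surely, since the service is nonnegative only off a null
        -- set.
        refine measure_mono_ae ?_
        filter_upwards [ae_serviceStrong_nonneg (N := N) has hρ hg] with ω hω h
        obtain ⟨τ, hτ, hc⟩ := exists_cumulative_lt_of_lt_queueDelay hlam hω h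
        exact Set.mem_biUnion (Finset.mem_coe.mpr (Finset.mem_range.mpr hτ)) hc
    _ ≤ ∑ τ ∈ Finset.range t, ENNReal.ofReal
          (Real.exp (lam * S) ^ (t - τ) * M ^ (t + θ - τ)) := by
        refine (measure_biUnion_finset_le _ _).trans (Finset.sum_le_sum fun τ hτ => ?_)
        refine (measure_cumulative_serviceStrong_le has hρ hg hind hS hM τ (t + θ) _).trans_eq ?_
        rw [← Real.exp_nat_mul, Nat.cast_sub (Finset.mem_range.mp hτ).le]
        congr 3
        ring
    _ = ENNReal.ofReal (∑ τ ∈ Finset.range t,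
          Real.exp (lam * S) ^ (t - τ) * M ^ (t + θ - τ)) :=
        (ENNReal.ofReal_sum_of_nonneg fun τ _ => by positivity).symm
    _ ≤ _ := ENNReal.ofReal_le_ofReal
        (sum_pow_sub_mul_pow_le hM0 (Real.exp_pos _).le hlt t θ)

end Delay

theorem theorem1 {W : Type*} [MeasurableSpace W] (P : Measure W) [IsProbabilityMeasure P]
    (α μ N : ℕ) (hα : 0 < α) (hμ : 0 < μ) (hN : 0 < N)
    (as ρ Ωs : ℝ) (has : 0 < as) (hρ : 0 < ρ) (hΩs : 0 < Ωs) :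
    -- the G-function in the closed form is given by an absolutely convergent integral, which is
    -- the same along each separating line
    (∀ S : ℝ, 0 < S →
      (∃ c : ℝ, MeijerGSeparates (2 + α) α (upperParams α μ) (lowerParams α μ (varpi N S)) c) ∧
      (∀ c : ℝ,
        MeijerGSeparates (2 + α) α (upperParams α μ) (lowerParams α μ (varpi N S)) c →
        Integrable (fun y : ℝ => meijerGIntegrand (2 + α) α (upperParams α μ)
          (lowerParams α μ (varpi N S)) (meijerArg α μ as ρ Ωs : ℂ) (c + y * Complex.I)) ∧
        meijerG (2 + α) α (upperParams α μ) (lowerParams α μ (varpi N S))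
            (meijerArg α μ as ρ Ωs : ℂ) =
          meijerGLine (2 + α) α (upperParams α μ) (lowerParams α μ (varpi N S))
            (meijerArg α μ as ρ Ωs : ℂ) c)) ∧
    -- the Mellin transform
    (∀ g : W → ℝ, HasLaw g (alphaMuGainLaw α μ Ωs) P → ∀ S : ℝ, 0 < S →
      Integrable (fun ω => phiStrong N as ρ (g ω) ^ (-S)) P ∧
      mellinRV P (fun ω => phiStrong N as ρ (g ω)) (1 - S) =
        ∫ ω, (1 + as * ρ * g ω) ^ (-varpi N S) ∂P ∧
      (mellinRV P (fun ω => phiStrong N as ρ (g ω)) (1 - S) : ℂ) =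
        mellinClosedForm α μ as ρ Ωs (varpi N S)) ∧
    -- the bound on the delay violation probability
    (∀ g : ℕ → W → ℝ, (∀ k, HasLaw (g k) (alphaMuGainLaw α μ Ωs) P) → iIndepFun g P →
      ∀ lam : ℝ, 0 ≤ lam → ∀ t θ : ℕ,
        P {ω | (θ : ℕ∞) <
            queueDelay (fun _ => lam) (fun k => serviceStrong N as ρ (g k ω)) t} ≤
          ⨅ (S : ℝ) (_ : 0 < S)
            (_ : Real.exp (lam * S) * (mellinClosedForm α μ as ρ Ωs (varpi N S)).re < 1),
            ENNReal.ofReal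
              ((mellinClosedForm α μ as ρ Ωs (varpi N S)).re ^ θ /
                (1 - Real.exp (lam * S) *
                  (mellinClosedForm α μ as ρ Ωs (varpi N S)).re))) := by
  refine ⟨fun S hS => ⟨exists_meijerGSeparates_alphaMu hα hμ (varpi_pos hN hS), fun c hc =>
      ⟨integrable_meijerGIntegrand_alphaMu hα hμ has hρ hΩs hc,
        meijerG_alphaMu_eq_meijerGLine hα hμ has hρ hΩs (varpi_pos hN hS) hc⟩⟩,
    fun g hg S hS => ⟨integrable_phiStrong_rpow_neg has hρ hg hS, mellinRV_phiStrong has hρ hg S,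
      mellinRV_phiStrong_eq_mellinClosedForm has hρ hg hα hμ hN hΩs hS⟩,
    fun g hg hind lam hlam t θ => ?_⟩
  -- Each admissible `S` is treated separately; if there is none, the infimum is `⊤`.
  refine le_iInf fun S => le_iInf fun hS => le_iInf fun hlt => ?_
  refine measure_lt_queueDelay_le has hρ hg hind hS hlam (fun k => ?_) hlt t θ
  rw [← mellinRV_phiStrong_eq_mellinClosedForm has hρ (hg k) hα hμ hN hΩs hS, Complex.ofReal_re]
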